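/- For $b\in\mathbb{C}$ let $p_b(z)=z^3+6z+b$, and let $H_b$ be Halley's method applied to $p_b$, i.e. the rational self-map of the Riemann sphere $\widehat{\mathbb{C}}=\mathbb{C}\cup\{\infty\}$ given by $$H_b(z)=z-\frac{2p_b(z)p_b'(z)}{2p_b'(z)^2-p_b(z)p_b''(z)} .$$ The Fatou set $\mathcal{F}(H_b)$ is the set of points of $\widehat{\mathbb{C}}$ having a neighbourhood on which the family of iterates $\{H_b^n\}_{n\ge 0}$ is normal, and a Fatou component is a connected component of $\mathcal{F}(H_b)$. A Fatou component $U$ is a Siegel disk (respectively a Herman ring) if there are an integer $k\ge 1$ with $H_b^k(U)\subseteq U$, an irrational number $\theta$, and an analytic homeomorphism $\phi$ from $U$ onto $\{z\in\mathbb{C}:|z|<1\}$ (respectively onto $\{z\in\mathbb{C}:1<|z|<r\}$ for some real $r>1$) such that $\phi\circ H_b^k\circ\phi^{-1}(z)=e^{2\pi i\theta}z$ for all $z$ in the image of $\phi$. A rotation domain is a Fatou component that is a Siegel disk or a Herman ring. If $b$ is real, then $H_b$ has no rotation domain. -/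

import Mathlib

open Polynomial

noncomputable section

namespace HalleyDynamics

/-- The extended complex plane `ℂ ∪ {∞}`, with the topology of the one-point compactification. -/
abbrev Sphere : Type := OnePoint ℂ

/-- The self-map of the sphere given by a rational function in lowest terms `P / Q`.
Poles are sent to `∞`. With `d = max (deg P) (deg Q)`, the value at `∞` is the quotient of the
coefficients of degree `d` of `P` and `Q`, read as `∞` if that of `Q` vanishes. -/
def ratMap (R : RatFunc ℂ) : Sphere → Sphere
  | OnePoint.some z =>
      if R.denom.eval z = 0 then OnePoint.infty
      else OnePoint.some (R.num.eval z / R.denom.eval z)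
  | OnePoint.infty =>
      let d := max R.num.natDegree R.denom.natDegree
      if R.denom.coeff d = 0 then OnePoint.infty
      else OnePoint.some (R.num.coeff d / R.denom.coeff d)

/-- Halley's method `z - 2 p p' / (2 p'² - p p'')` as a rational function. -/
def halley (p : ℂ[X]) : RatFunc ℂ :=
  RatFunc.X -
    algebraMap ℂ[X] (RatFunc ℂ) (2 * p * derivative p) /
      algebraMap ℂ[X] (RatFunc ℂ)
        (2 * derivative p ^ 2 - p * derivative (derivative p))

/-- The cubic polynomial `z³ + 6 z + b`. -/
def cubic (b : ℂ) : ℂ[X] := X ^ 3 + 6 * X + C b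

/-- A family of self-maps of the sphere is normal on `V` if every sequence in it has a subsequence
converging locally uniformly on `V`. Uniformity is that of the compact Hausdorff sphere (its unique
compatible uniform structure, which is that of the spherical metric). -/
def IsNormalOn (F : Set (Sphere → Sphere)) (V : Set Sphere) : Prop :=
  letI : UniformSpace Sphere := uniformSpaceOfCompactR1
  ∀ f : ℕ → Sphere → Sphere, (∀ n, f n ∈ F) →
    ∃ s : ℕ → ℕ, StrictMono s ∧ ∃ g : Sphere → Sphere,
      TendstoLocallyUniformlyOn (fun n => f (s n)) g Filter.atTop V

/-- The Fatou set: points near which the family of iterates is normal. -/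
def fatouSet (R : Sphere → Sphere) : Set Sphere :=
  {z | ∃ V : Set Sphere, IsOpen V ∧ z ∈ V ∧ IsNormalOn (Set.range fun n : ℕ => R^[n]) V}

/-- `U` is a connected component of the Fatou set. -/
def IsFatouComponent (R : Sphere → Sphere) (U : Set Sphere) : Prop :=
  ∃ z ∈ fatouSet R, U = connectedComponentIn (fatouSet R) z

/-- The inverse of the chart `z ↦ 1 / z` at `∞`. -/
def chartInfty (w : ℂ) : Sphere := if w = 0 then OnePoint.infty else OnePoint.some w⁻¹

/-- A complex-valued function is holomorphic on the open subset `U` of the sphere if it is so in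
both of the standard charts `z` and `1 / z`. -/
def HolomorphicOn (φ : Sphere → ℂ) (U : Set Sphere) : Prop :=
  DifferentiableOn ℂ (fun z : ℂ => φ (OnePoint.some z)) {z : ℂ | OnePoint.some z ∈ U} ∧
    DifferentiableOn ℂ (fun w : ℂ => φ (chartInfty w)) {w : ℂ | chartInfty w ∈ U}

/-- `S` maps `U` into itself and some analytic homeomorphism from `U` onto `W ⊆ ℂ` conjugates
`S` on `U` to an irrational rotation. -/
def IsConjToIrrationalRotation (S : Sphere → Sphere) (U : Set Sphere) (W : Set ℂ) : Prop :=
  Set.MapsTo S U U ∧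
    ∃ φ : OpenPartialHomeomorph Sphere ℂ, φ.source = U ∧ φ.target = W ∧ HolomorphicOn φ U ∧
      ∃ θ : ℝ, Irrational θ ∧
        ∀ z ∈ W, φ (S (φ.symm z)) = Complex.exp (2 * Real.pi * Complex.I * θ) * z

/-- A (periodic) Siegel disk: a Fatou component on which some iterate `R^k`, `k ≥ 1`, is
conjugate to an irrational rotation of the unit disk. -/
def IsSiegelDisk (R : Sphere → Sphere) (U : Set Sphere) : Prop :=
  IsFatouComponent R U ∧
    ∃ k : ℕ, 1 ≤ k ∧ IsConjToIrrationalRotation R^[k] U {z : ℂ | ‖z‖ < 1}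

/-- A (periodic) Herman ring: a Fatou component on which some iterate `R^k`, `k ≥ 1`, is
conjugate to an irrational rotation of a round annulus. -/
def IsHermanRing (R : Sphere → Sphere) (U : Set Sphere) : Prop :=
  IsFatouComponent R U ∧
    ∃ k : ℕ, 1 ≤ k ∧ ∃ r : ℝ, 1 < r ∧
      IsConjToIrrationalRotation R^[k] U {z : ℂ | 1 < ‖z‖ ∧ ‖z‖ < r}

/-- A rotation domain is a Siegel disk or a Herman ring. -/
def IsRotationDomain (R : Sphere → Sphere) (U : Set Sphere) : Prop :=
  IsSiegelDisk R U ∨ IsHermanRing R U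

end HalleyDynamics

end

/-!
On a rotation domain some iterates of arbitrarily high order converge locally uniformly to the
identity, whether the rotation angle is irrational or not. A nonempty open set `U` on which this
happens cannot exist. Put a real root `r` of the cubic at `∞` by the coordinate `w = 1 / (z - r)`.
The orbit of a point of `U` never reaches `r`, and Halley's map does not decrease `|w|` near `∞`.

Let `α` be the root of the cubic in a half-plane `± Im w > 0` that meets `U`. The critical points
off the real line are roots and the real line is invariant, so the half-plane contains no
postcritical point other than `α`. Cut it by a line through `α` to get a convex region `D` that
meets `U`, has `α` on its boundary and is free of postcritical points. The inverse branches on `D`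
of the returning iterates are locally bounded, because Halley's map does not decrease `|w|` near
`∞`. They converge to the identity on `D ∩ U`, hence on all of `D` by Vitali's theorem. Near `α`,
however, all iterates converge to `α`, because every root is superattracting: a contradiction.
-/

open Filter Metric Set
open scoped Topology

noncomputable section

namespace HalleyDynamics

theorem tendstoLocallyUniformlyOn_iff_tendsto_prod {ι α β : Type*} [TopologicalSpace α]
    [UniformSpace β] {f : ι → α → β} {g : α → β} {l : Filter ι} {s : Set α} (hs : IsOpen s)
    (hg : ContinuousOn g s) :
    TendstoLocallyUniformlyOn f g l s ↔
      ∀ x ∈ s, Tendsto (fun y : ι × α => f y.1 y.2) (l ×ˢ 𝓝 x) (𝓝 (g x)) := by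
  rw [hs.tendstoLocallyUniformlyOn_iff_forall_tendsto]
  refine forall₂_congr fun x hx => ?_
  have hgx : Tendsto (fun y : ι × α => g y.2) (l ×ˢ 𝓝 x) (𝓝 (g x)) :=
    (hg.continuousAt (hs.mem_nhds hx)).tendsto.comp tendsto_snd
  exact ⟨hgx.congr_uniformity, fun h => (hgx.prodMk_nhds h).mono_right (nhds_le_uniformity _)⟩

section Vitali

variable {ι F : Type*} [NormedAddCommGroup F] [NormedSpace ℂ F] [CompleteSpace F]
  {f : ι → ℂ → F} {g : ℂ → F} {l : Filter ι} {c : ℂ} {R M : ℝ} {D U V : Set ℂ}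

theorem norm_taylorTerm_le {f : ℂ → F} {z : ℂ} {r ρ : ℝ} (hρ : 0 < ρ)
    (hf : DiffContOnCl ℂ f (ball c ρ)) (hb : ∀ w ∈ sphere c ρ, ‖f w‖ ≤ M)
    (hz : z ∈ closedBall c r) (k : ℕ) :
    ‖(k.factorial : ℂ)⁻¹ • (z - c) ^ k • iteratedDeriv k f c‖ ≤ M * (r / ρ) ^ k := by
  have hcauchy := Complex.norm_iteratedDeriv_le_of_forall_mem_sphere_norm_le k hρ hf hb
  rw [mem_closedBall, dist_eq_norm] at hz
  have hr : 0 ≤ r := (norm_nonneg _).trans hz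
  rw [norm_smul, norm_smul, norm_inv, norm_pow, Complex.norm_natCast]
  calc (k.factorial : ℝ)⁻¹ * (‖z - c‖ ^ k * ‖iteratedDeriv k f c‖)
      ≤ (k.factorial : ℝ)⁻¹ * (r ^ k * (k.factorial * M / ρ ^ k)) := by gcongr
    _ = M * (r / ρ) ^ k := by rw [div_pow]; field_simp

theorem tendstoLocallyUniformlyOn_iteratedDeriv (h : TendstoLocallyUniformlyOn f g l U)
    (hf : ∀ᶠ j in l, DifferentiableOn ℂ (f j) U) (hU : IsOpen U) (k : ℕ) :
    TendstoLocallyUniformlyOn (fun j => iteratedDeriv k (f j)) (iteratedDeriv k g) l U := by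
  simp only [iteratedDeriv_eq_iterate]
  induction k with
  | zero => exact h
  | succ k ih =>
    simp only [Function.iterate_succ_apply']
    exact ih.deriv (hf.mono fun j hj =>
      ((hj.analyticOnNhd hU).iterated_deriv k).differentiableOn) hU

/-- The Taylor series at `c` are dominated by a common geometric series, and each of their
coefficients tends to zero. -/
theorem tendstoLocallyUniformlyOn_zero_ball (hf : ∀ᶠ j in l, DifferentiableOn ℂ (f j) (ball c R))
    (hb : ∀ᶠ j in l, ∀ z ∈ ball c R, ‖f j z‖ ≤ M) (hU : IsOpen U) (hcU : c ∈ U)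
    (hfU : ∀ᶠ j in l, DifferentiableOn ℂ (f j) U) (h : TendstoLocallyUniformlyOn f 0 l U) :
    TendstoLocallyUniformlyOn f 0 l (ball c R) := by
  refine (tendstoLocallyUniformlyOn_iff_tendsto_prod isOpen_ball continuousOn_const).2
    fun z hz => ?_
  obtain ⟨r, hzr, hrR⟩ := exists_between (mem_ball.1 hz)
  obtain ⟨ρ, hrρ, hρR⟩ := exists_between hrR
  have hr : 0 < r := dist_nonneg.trans_lt hzr
  have hρ : 0 < ρ := hr.trans hrρ
  have hcoeff (k : ℕ) : Tendsto (fun j => iteratedDeriv k (f j) c) l (𝓝 0) := by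
    simpa using (tendstoLocallyUniformlyOn_iteratedDeriv h hfU hU k).tendsto_at hcU
  have hseries : Tendsto (fun y : ι × ℂ =>
      ∑' k : ℕ, (k.factorial : ℂ)⁻¹ • (y.2 - c) ^ k • iteratedDeriv k (f y.1) c) (l ×ˢ 𝓝 z)
      (𝓝 (∑' k : ℕ, (k.factorial : ℂ)⁻¹ • (z - c) ^ k • (0 : F))) := by
    refine tendsto_tsum_of_dominated_convergence (bound := fun k => M * (r / ρ) ^ k)
      ((summable_geometric_of_lt_one (by positivity) ((div_lt_one hρ).2 hrρ)).mul_left _)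
      (fun k => ?_) ?_
    · have hpow : Tendsto (fun y : ι × ℂ => (y.2 - c) ^ k) (l ×ˢ 𝓝 z) (𝓝 ((z - c) ^ k)) :=
        ((tendsto_id.sub_const c).pow k).comp tendsto_snd
      exact (hpow.smul ((hcoeff k).comp tendsto_fst)).const_smul _
    · filter_upwards [tendsto_fst.eventually (hf.and hb),
        tendsto_snd.eventually (isOpen_ball.mem_nhds hzr)] with y ⟨hfy, hby⟩ hy k
      have hsub := closedBall_subset_ball (x := c) hρR
      exact norm_taylorTerm_le hρ (hfy.diffContOnCl_ball hsub)
        (fun w hw => hby _ (hsub (sphere_subset_closedBall hw))) (ball_subset_closedBall hy) k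
  simp only [smul_zero, tsum_zero] at hseries
  refine hseries.congr' ?_
  filter_upwards [tendsto_fst.eventually hf,
    tendsto_snd.eventually (isOpen_ball.mem_nhds hz)] with y hfy hy
  exact Complex.taylorSeries_eq_on_ball hfy hy

theorem tendstoLocallyUniformlyOn_zero_of_isPreconnected (hD : IsOpen D) (hDc : IsPreconnected D)
    (hf : ∀ᶠ j in l, DifferentiableOn ℂ (f j) D)
    (hb : ∀ z ∈ D, ∃ M, ∀ᶠ y in l ×ˢ 𝓝 z, ‖f y.1 y.2‖ ≤ M) (hV : IsOpen V)
    (hDV : (D ∩ V).Nonempty) (h : TendstoLocallyUniformlyOn f 0 l V) :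
    TendstoLocallyUniformlyOn f 0 l D := by
  set S : Set (Set ℂ) := {U | IsOpen U ∧ U ⊆ D ∧ TendstoLocallyUniformlyOn f 0 l U}
  have hSopen : ∀ U ∈ S, IsOpen U := fun U hU => hU.1
  suffices hsub : D ⊆ ⋃₀ S from
    (tendstoLocallyUniformlyOn_sUnion S hSopen fun U hU => hU.2.2).mono hsub
  refine hDc.subset_of_closure_inter_subset (isOpen_sUnion hSopen) ?_ fun z hz => ?_
  · obtain ⟨c, hcD, hcV⟩ := hDV
    exact ⟨c, hcD, D ∩ V, ⟨hD.inter hV, inter_subset_left, h.mono inter_subset_right⟩, hcD, hcV⟩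
  · obtain ⟨M, hM⟩ := hb z hz.2
    obtain ⟨p, hp, q, hq, hpq⟩ := eventually_prod_iff.1 hM
    obtain ⟨R, hR, hball⟩ := nhds_basis_ball.eventually_iff.1 ((hD.eventually_mem hz.2).and hq)
    obtain ⟨c, ⟨U, ⟨hUo, hUD, hUlim⟩, hcU⟩, hcz⟩ := mem_closure_iff.1 hz.1 (R / 2) (half_pos hR)
    rw [dist_comm] at hcz
    have hsub : ball c (R / 2) ⊆ ball z R := ball_subset (by linarith)
    have hsubD : ball c (R / 2) ⊆ D := fun w hw => (hball (hsub hw)).1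
    refine ⟨ball c (R / 2), ⟨isOpen_ball, hsubD, ?_⟩, mem_ball'.2 hcz⟩
    exact tendstoLocallyUniformlyOn_zero_ball (hf.mono fun j hj => hj.mono hsubD)
      (hp.mono fun j hj w hw => hpq hj (hball (hsub hw)).2) hUo hcU
      (hf.mono fun j hj => hj.mono hUD) hUlim

theorem tendstoLocallyUniformlyOn_of_isPreconnected (hD : IsOpen D) (hDc : IsPreconnected D)
    (hf : ∀ᶠ j in l, DifferentiableOn ℂ (f j) D)
    (hb : ∀ z ∈ D, ∃ M, ∀ᶠ y in l ×ˢ 𝓝 z, ‖f y.1 y.2‖ ≤ M) (hg : DifferentiableOn ℂ g D)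
    (hV : IsOpen V) (hDV : (D ∩ V).Nonempty) (h : TendstoLocallyUniformlyOn f g l V) :
    TendstoLocallyUniformlyOn f g l D := by
  have hsub {W : Set ℂ} : TendstoLocallyUniformlyOn (fun j => f j - g) 0 l W ↔
      TendstoLocallyUniformlyOn f g l W := by
    simp only [tendstoLocallyUniformlyOn_iff, Pi.zero_apply, Pi.sub_apply, dist_zero_left,
      dist_comm (g _), dist_eq_norm (f _ _)]
  rw [← hsub] at h ⊢
  refine tendstoLocallyUniformlyOn_zero_of_isPreconnected hD hDc (hf.mono fun j hj => hj.sub hg)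
    (fun z hz => ?_) hV hDV h
  obtain ⟨M, hM⟩ := hb z hz
  have hgz : ∀ᶠ w in 𝓝 z, ‖g w‖ < ‖g z‖ + 1 :=
    (hg.continuousOn.continuousAt (hD.mem_nhds hz)).norm.eventually_lt_const (lt_add_one _)
  refine ⟨M + (‖g z‖ + 1), ?_⟩
  filter_upwards [hM, tendsto_snd.eventually hgz] with y hfy hgy
  exact (norm_sub_le _ _).trans (add_le_add hfy hgy.le)

end Vitali

section ProperHolomorphic

/-- `f` is holomorphic on the open set `E ⊆ ℂ` and proper as a map from `E` to `ℂ`. The values of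
`f` outside `E` play no role. -/
structure IsProperHolomorphicOn (f : ℂ → ℂ) (E : Set ℂ) : Prop where
  isOpen : IsOpen E
  differentiableOn : DifferentiableOn ℂ f E
  isCompact_inter_preimage : ∀ K, IsCompact K → IsCompact (E ∩ f ⁻¹' K)

/-- The points at which the first `n` iterates of the partial map `f` with domain `E` are
defined. -/
def iterateDomain {X : Type*} (f : X → X) (E : Set X) (n : ℕ) : Set X := {w | ∀ i < n, f^[i] w ∈ E}

section IterateDomain

variable {X : Type*} {f : X → X} {E : Set X}

theorem iterateDomain_zero : iterateDomain f E 0 = univ := by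
  simp [iterateDomain]

theorem iterateDomain_succ (n : ℕ) :
    iterateDomain f E (n + 1) = E ∩ f ⁻¹' iterateDomain f E n := by
  ext w
  simp only [iterateDomain, Nat.forall_lt_succ_left, mem_ofPred_eq, mem_inter_iff, mem_preimage,
    Function.iterate_succ_apply, Function.iterate_zero, id]

theorem iterateDomain_anti {m n : ℕ} (h : m ≤ n) : iterateDomain f E n ⊆ iterateDomain f E m :=
  fun _ hw i hi => hw i (hi.trans_le h)

end IterateDomain

variable {f g : ℂ → ℂ} {E E' B D : Set ℂ} {a : ℂ}

namespace IsProperHolomorphicOn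

protected theorem id : IsProperHolomorphicOn id univ where
  isOpen := isOpen_univ
  differentiableOn := differentiableOn_id
  isCompact_inter_preimage K hK := by simpa using hK

protected theorem comp (hg : IsProperHolomorphicOn g E') (hf : IsProperHolomorphicOn f E) :
    IsProperHolomorphicOn (g ∘ f) (E ∩ f ⁻¹' E') where
  isOpen := hf.differentiableOn.continuousOn.isOpen_inter_preimage hf.isOpen hg.isOpen
  differentiableOn := hg.differentiableOn.comp (hf.differentiableOn.mono inter_subset_left)
    fun _ hw => hw.2
  isCompact_inter_preimage K hK := by
    rw [inter_assoc, preimage_comp, ← preimage_inter]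
    exact hf.isCompact_inter_preimage _ (hg.isCompact_inter_preimage K hK)

protected theorem iterate (hf : IsProperHolomorphicOn f E) (n : ℕ) :
    IsProperHolomorphicOn f^[n] (iterateDomain f E n) := by
  induction n with
  | zero => exact iterateDomain_zero (f := f) ▸ IsProperHolomorphicOn.id
  | succ n ih =>
    rw [iterateDomain_succ]
    exact ih.comp hf

protected theorem hasStrictDerivAt (hf : IsProperHolomorphicOn f E) {w : ℂ} (hw : w ∈ E) :
    HasStrictDerivAt f (deriv f w) w :=
  (hf.differentiableOn.analyticAt (hf.isOpen.mem_nhds hw)).hasStrictDerivAt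

theorem isLocalHomeomorphOn_domRestrict (hf : IsProperHolomorphicOn f E)
    (hcrit : ∀ w ∈ E, f w ∈ D → deriv f w ≠ 0) :
    IsLocalHomeomorphOn (E.domRestrict f) (E.domRestrict f ⁻¹' D) := by
  have hloc : IsLocalHomeomorphOn f (E ∩ f ⁻¹' D) := fun w hw => by
    have hs := (hf.hasStrictDerivAt hw.1).hasStrictFDerivAt_equiv (hcrit w hw.1 hw.2)
    exact ⟨hs.toOpenPartialHomeomorph _, hs.mem_toOpenPartialHomeomorph_source,
      hs.toOpenPartialHomeomorph_coe.symm⟩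
  exact hloc.comp (hf.isOpen.isOpenEmbedding_subtypeVal.isLocalHomeomorph.isLocalHomeomorphOn)
    fun w hw => ⟨w.2, hw⟩

theorem isCompact_preimage_domRestrict (hf : IsProperHolomorphicOn f E) {K : Set ℂ}
    (hK : IsCompact K) : IsCompact (E.domRestrict f ⁻¹' K) := by
  rw [Subtype.isCompact_iff]
  convert hf.isCompact_inter_preimage K hK using 1
  rw [domRestrict_eq, preimage_comp, Subtype.image_preimage_coe]

theorem isCoveringMapOn_domRestrict (hf : IsProperHolomorphicOn f E)
    (hcrit : ∀ w ∈ E, f w ∈ D → deriv f w ≠ 0) : IsCoveringMapOn (E.domRestrict f) D := by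
  have hlocal := hf.isLocalHomeomorphOn_domRestrict hcrit
  have hproper : IsProperMap (E.domRestrict f) := isProperMap_iff_isCompact_preimage.2
    ⟨hf.differentiableOn.continuousOn.domRestrict, fun _ => hf.isCompact_preimage_domRestrict⟩
  refine hproper.isClosedMap.isCoveringMapOn_of_isLocalHomeomorphOn (fun x hx => ?_) hlocal
  refine (hf.isCompact_preimage_domRestrict isCompact_singleton).finite
    (.of_openPartialHomeomorph (E.domRestrict f) subset_rfl fun e he => ?_)
  obtain ⟨ψ, hψ, hψf⟩ := hlocal e (by rwa [mem_preimage, mem_singleton_iff.1 he])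
  exact ⟨ψ, hψ, hψf.symm⟩

theorem exists_inverseBranch (hf : IsProperHolomorphicOn f E) (hD : IsOpen D)
    [SimplyConnectedSpace D] (hcrit : ∀ w ∈ E, f w ∈ D → deriv f w ≠ 0) (ha : a ∈ E)
    (hfa : f a ∈ D) :
    ∃ g : ℂ → ℂ, DifferentiableOn ℂ g D ∧ MapsTo g D E ∧ RightInvOn g f D ∧ g (f a) = a := by
  have : LocallyPathConnectedSpace D := hD.locallyPathConnectedSpace
  have hcov := hf.isCoveringMapOn_domRestrict hcrit
  obtain ⟨F, ⟨hFa, hFf⟩, -⟩ := hcov.existsUnique_continuousMap_lifts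
    (⟨Subtype.val, continuous_subtype_val⟩ : C(D, ℂ)) (a₀ := ⟨f a, hfa⟩) (e₀ := ⟨a, ha⟩) rfl
    (fun x => x.2)
  set g : ℂ → ℂ := Function.extend Subtype.val (fun w : D => (F w : ℂ)) 0
  have hgF (w : D) : g w = F w := Subtype.val_injective.extend_apply _ _ w
  have hmaps : MapsTo g D E := fun w hw => by
    rw [hgF ⟨w, hw⟩]
    exact (F ⟨w, hw⟩).2
  have hinv : RightInvOn g f D := fun w hw => by
    rw [hgF ⟨w, hw⟩]
    exact congrFun hFf ⟨w, hw⟩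
  have hcont : ContinuousOn g D := by
    rw [continuousOn_iff_continuous_domRestrict, show D.domRestrict g = fun w => (F w : ℂ) from
      funext hgF]
    fun_prop
  refine ⟨g, fun w hw => ?_, hmaps, hinv, by rw [hgF ⟨f a, hfa⟩, hFa]⟩
  have hfgw : f (g w) ∈ D := by rwa [hinv hw]
  exact (HasDerivAt.of_local_left_inverse (hcont.continuousAt (hD.mem_nhds hw))
    (hf.hasStrictDerivAt (hmaps hw)).hasDerivAt (hcrit _ (hmaps hw) hfgw)
    (eventually_of_mem (hD.mem_nhds hw) hinv)).differentiableAt.differentiableWithinAt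

end IsProperHolomorphicOn

theorem leftInvOn_of_rightInvOn (hf : DifferentiableOn ℂ f B) (hB : IsOpen B)
    (hBc : IsPreconnected B) (hg : DifferentiableOn ℂ g D) (hmaps : MapsTo f B D)
    (hinv : RightInvOn g f D) (ha : a ∈ B) (hga : g (f a) = a) (hcrit : deriv f a ≠ 0) :
    LeftInvOn g f B := by
  have hgf : DifferentiableOn ℂ (g ∘ f) B := hg.comp hf hmaps
  refine (hgf.analyticOnNhd hB).eqOn_of_preconnected_of_eventuallyEq (g := id)
    (fun z _ => analyticAt_id) hBc ha ?_
  have hnhds := hB.mem_nhds ha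
  have hlocal := (hf.analyticAt hnhds).hasStrictDerivAt.eventually_left_inverse hcrit
  have hcont : Tendsto (g ∘ f) (𝓝 a) (𝓝 a) := by
    simpa only [Function.comp_apply, hga] using (hgf.continuousOn.continuousAt hnhds).tendsto
  filter_upwards [hlocal, hcont.eventually hlocal, hnhds] with y hy hgfy hyB
  rw [Function.comp_apply, hinv (hmaps hyB), hy] at hgfy
  exact hgfy.symm

end ProperHolomorphic

section LeftInverse

variable {ι : Type*} {f g : ι → ℂ → ℂ} {l : Filter ι} {B D : Set ℂ}

/-- By the Schwarz lemma the bounded maps `g j` are uniformly Lipschitz near each point, and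
`g j w - w = g j w - g j (f j w)`. -/
theorem tendstoLocallyUniformlyOn_leftInverse (hD : IsOpen D) (hB : IsOpen B) (hBD : B ⊆ D)
    (hg : ∀ᶠ j in l, DifferentiableOn ℂ (g j) D)
    (hb : ∀ z ∈ D, ∃ M, ∀ᶠ y in l ×ˢ 𝓝 z, ‖g y.1 y.2‖ ≤ M)
    (hinv : ∀ᶠ j in l, LeftInvOn (g j) (f j) B) (hf : TendstoLocallyUniformlyOn f id l B) :
    TendstoLocallyUniformlyOn g id l B := by
  simp only [hB.tendstoLocallyUniformlyOn_iff_forall_tendsto,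
    tendsto_uniformity_iff_dist_tendsto_zero] at hf ⊢
  intro z hz
  obtain ⟨M, hM⟩ := hb z (hBD hz)
  obtain ⟨p, hp, q, hq, hpq⟩ := eventually_prod_iff.1 hM
  obtain ⟨s, hs, hball⟩ := nhds_basis_ball.eventually_iff.1 ((hD.eventually_mem (hBD hz)).and hq)
  have hlip : ∀ᶠ y in l ×ˢ 𝓝 z,
      dist y.2 (g y.1 y.2) ≤ (2 * M + 1) / (s / 2) * dist y.2 (f y.1 y.2) := by
    filter_upwards [tendsto_fst.eventually (hg.and (hinv.and hp)),
      tendsto_snd.eventually (hB.mem_nhds hz),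
      tendsto_snd.eventually (ball_mem_nhds z (half_pos hs)),
      (hf z hz).eventually_lt_const (half_pos hs)] with ⟨j, w⟩ ⟨hgj, hinvj, hpj⟩ hwB hws hfw
    have hsub : ball w (s / 2) ⊆ ball z s := ball_subset (by linarith [mem_ball.1 hws])
    have hmaps : MapsTo (g j) (ball w (s / 2)) (closedBall (g j w) (2 * M + 1)) := fun v hv => by
      have hv := hpq hpj (hball (hsub hv)).2
      have hw := hpq hpj (hball (hsub (mem_ball_self (half_pos hs)))).2
      rw [mem_closedBall, dist_eq_norm]
      linarith [norm_sub_le (g j v) (g j w)]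
    rw [id, dist_comm] at hfw
    have hschwarz := Complex.dist_le_div_mul_dist_of_mapsTo_ball
      (hgj.mono fun v hv => (hball (hsub hv)).1) hmaps hfw
    rwa [hinvj hwB, dist_comm (f j w)] at hschwarz
  exact squeeze_zero' (.of_forall fun _ => dist_nonneg) hlip
    (by simpa using (hf z hz).const_mul ((2 * M + 1) / (s / 2)))

end LeftInverse

theorem exists_tendstoUniformlyOn_iterate_of_norm_deriv_lt_one {𝕜 : Type*}
    [NontriviallyNormedField 𝕜] {f : 𝕜 → 𝕜} {f' x : 𝕜} (hf : HasDerivAt f f' x) (hx : f x = x)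
    (hf' : ‖f'‖ < 1) :
    ∃ η > 0, TendstoUniformlyOn (fun n => f^[n]) (fun _ => x) atTop (ball x η) := by
  obtain ⟨c, hc, hc1⟩ := exists_between hf'
  have hc0 : 0 ≤ c := (norm_nonneg _).trans hc.le
  have hcontr : ∀ᶠ w in 𝓝 x, dist (f w) x ≤ c * dist w x := by
    filter_upwards [(hasDerivAt_iff_isLittleO.1 hf).def (sub_pos.2 hc)] with w hw
    have hsplit := norm_add_le (f w - f x - (w - x) • f') ((w - x) • f')
    rw [sub_add_cancel, hx, norm_smul] at hsplit
    rw [hx] at hw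
    rw [dist_eq_norm, dist_eq_norm]
    linarith
  obtain ⟨η, hη, hball⟩ := nhds_basis_ball.eventually_iff.1 hcontr
  have hiter (n : ℕ) : ∀ w ∈ ball x η, dist (f^[n] w) x ≤ c ^ n * dist w x := by
    induction n with
    | zero => simp
    | succ n ih =>
      intro w hw
      have hfw := hball hw
      rw [Function.iterate_succ_apply, pow_succ, mul_assoc]
      refine (ih (f w) (mem_ball.2 ?_)).trans (by gcongr)
      exact hfw.trans_lt ((mul_le_of_le_one_left dist_nonneg hc1.le).trans_lt hw)
  refine ⟨η, hη, Metric.tendstoUniformlyOn_iff.2 fun ε hε => ?_⟩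
  have hpow : Tendsto (fun n => c ^ n * η) atTop (𝓝 0) := by
    simpa using (tendsto_pow_atTop_nhds_zero_of_lt_one hc0 hc1).mul_const η
  filter_upwards [hpow.eventually_lt_const hε] with n hn w hw
  rw [dist_comm]
  refine (hiter n w hw).trans_lt (lt_of_le_of_lt ?_ hn)
  have := (mem_ball.1 hw).le
  gcongr

section Rigidity

/-- Along a filter of times that tends to infinity, the iterates of `S` converge to the identity
locally uniformly near the points of `U`; uniformity is expressed by letting the argument tend to
`x` together with the time. -/
def IsRigidOn {X : Type*} [TopologicalSpace X] (S : X → X) (U : Set X) : Prop :=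
  ∃ l : Filter ℕ, l.NeBot ∧ l ≤ atTop ∧
    ∀ x ∈ U, Tendsto (fun y : ℕ × X => S^[y.1] y.2) (l ×ˢ 𝓝 x) (𝓝 x)

theorem IsRigidOn.of_iterate {X : Type*} [TopologicalSpace X] {S : X → X} {U : Set X} {k : ℕ}
    (h : IsRigidOn S^[k] U) (hk : 0 < k) : IsRigidOn S U := by
  obtain ⟨l, hne, hl, hlim⟩ := h
  refine ⟨l.map (k * ·), inferInstance, ?_, fun x hx => ?_⟩
  · exact (tendsto_id.const_mul_atTop' hk).mono_left hl
  · rw [prod_map_left, tendsto_map'_iff]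
    simpa only [Function.comp_def, Prod.map_fst, Prod.map_snd, id, Function.iterate_mul] using
      hlim x hx

variable {G : ℂ → ℂ} {E D B V : Set ℂ} {ρ : ℝ} {n : ℕ}

theorem norm_le_max_norm_iterate (hesc : ∀ w ∈ E, ρ ≤ ‖w‖ → ‖w‖ ≤ ‖G w‖) {w : ℂ}
    (hw : w ∈ iterateDomain G E n) : ‖w‖ ≤ max ρ ‖G^[n] w‖ := by
  induction n generalizing w with
  | zero => exact le_max_right _ _
  | succ n ih =>
    rw [iterateDomain_succ] at hw
    rcases le_total ‖w‖ ρ with hwρ | hρw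
    · exact le_max_of_le_left hwρ
    · exact (hesc w hw.1 hρw).trans (ih hw.2)

namespace IsProperHolomorphicOn

theorem deriv_iterate_ne_zero (hG : IsProperHolomorphicOn G E)
    (hcrit : ∀ w ∈ E, deriv G w = 0 → ∀ k, G^[k + 1] w ∉ D) {w : ℂ}
    (hw : w ∈ iterateDomain G E n) (hwD : G^[n] w ∈ D) : deriv G^[n] w ≠ 0 := by
  induction n generalizing w with
  | zero => simp
  | succ n ih =>
    rw [iterateDomain_succ] at hw
    rw [Function.iterate_succ, deriv_comp w
      ((hG.iterate n).hasStrictDerivAt hw.2).hasDerivAt.differentiableAt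
      (hG.hasStrictDerivAt hw.1).hasDerivAt.differentiableAt]
    exact mul_ne_zero (ih hw.2 hwD) fun h => hcrit w hw.1 h n hwD

theorem exists_iterate_inverseBranch (hG : IsProperHolomorphicOn G E)
    (hesc : ∀ w ∈ E, ρ ≤ ‖w‖ → ‖w‖ ≤ ‖G w‖) (hD : IsOpen D) [SimplyConnectedSpace D]
    (hcrit : ∀ w ∈ E, deriv G w = 0 → ∀ k, G^[k + 1] w ∉ D) (hB : IsOpen B)
    (hBc : IsConnected B) (hBE : B ⊆ iterateDomain G E n) (hmaps : MapsTo G^[n] B D) :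
    ∃ g : ℂ → ℂ, DifferentiableOn ℂ g D ∧ RightInvOn g G^[n] D ∧ LeftInvOn g G^[n] B ∧
      ∀ w ∈ D, ‖g w‖ ≤ max ρ ‖w‖ := by
  obtain ⟨a, ha⟩ := hBc.nonempty
  have hcritn : ∀ w ∈ iterateDomain G E n, G^[n] w ∈ D → deriv G^[n] w ≠ 0 := fun w hw hwD =>
    hG.deriv_iterate_ne_zero hcrit hw hwD
  obtain ⟨g, hgd, hgE, hinv, hga⟩ :=
    (hG.iterate n).exists_inverseBranch hD hcritn (hBE ha) (hmaps ha)
  refine ⟨g, hgd, hinv, ?_, fun w hw => ?_⟩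
  · exact leftInvOn_of_rightInvOn ((hG.iterate n).differentiableOn.mono hBE) hB hBc.isPreconnected
      hgd hmaps hinv ha hga (hcritn a (hBE ha) (hmaps ha))
  · simpa only [hinv hw] using norm_le_max_norm_iterate hesc (hgE hw)

theorem exists_inverseBranches_tendsto_id (hG : IsProperHolomorphicOn G E)
    (hesc : ∀ w ∈ E, ρ ≤ ‖w‖ → ‖w‖ ≤ ‖G w‖) (hD : IsOpen D) [SimplyConnectedSpace D]
    (hcrit : ∀ w ∈ E, deriv G w = 0 → ∀ k, G^[k + 1] w ∉ D) {l : Filter ℕ} (hV : IsOpen V)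
    (hDV : (D ∩ V).Nonempty) (hVE : ∀ n, V ⊆ iterateDomain G E n)
    (hlim : TendstoLocallyUniformlyOn (fun n => G^[n]) id l V) :
    ∃ g : ℕ → ℂ → ℂ, (∀ᶠ n in l, RightInvOn (g n) G^[n] D) ∧
      TendstoLocallyUniformlyOn g id l D := by
  obtain ⟨a, haD, haV⟩ := hDV
  obtain ⟨p, hp, q, hq, hpq⟩ := eventually_prod_iff.1
    (((tendstoLocallyUniformlyOn_iff_tendsto_prod hV continuousOn_id).1 hlim a haV).eventually
      (hD.mem_nhds haD))
  obtain ⟨r, hr, hball⟩ := nhds_basis_ball.eventually_iff.1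
    ((hD.eventually_mem haD).and ((hV.eventually_mem haV).and hq))
  set B := ball a r
  have hBV : B ⊆ V := fun w hw => (hball hw).2.1
  have hbranch : ∀ᶠ n in l, ∃ g : ℂ → ℂ, DifferentiableOn ℂ g D ∧ RightInvOn g G^[n] D ∧
      LeftInvOn g G^[n] B ∧ ∀ w ∈ D, ‖g w‖ ≤ max ρ ‖w‖ := by
    filter_upwards [hp] with n hn
    exact hG.exists_iterate_inverseBranch hesc hD hcrit isOpen_ball
      ((convex_ball a r).isConnected ⟨a, mem_ball_self hr⟩) (hBV.trans (hVE n))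
      fun w hw => hpq hn (hball hw).2.2
  obtain ⟨g, hg⟩ := Filter.skolem.1 hbranch
  have hgd : ∀ᶠ n in l, DifferentiableOn ℂ (g n) D := hg.mono fun n hn => hn.1
  have hgb : ∀ z ∈ D, ∃ M, ∀ᶠ y in l ×ˢ 𝓝 z, ‖g y.1 y.2‖ ≤ M := fun z hz => by
    refine ⟨max ρ (‖z‖ + 1), ?_⟩
    filter_upwards [tendsto_fst.eventually hg, tendsto_snd.eventually (hD.mem_nhds hz),
      tendsto_snd.eventually (continuous_norm.tendsto z |>.eventually_lt_const (lt_add_one _))]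
      with y hgy hyD hyz
    exact (hgy.2.2.2 _ hyD).trans (max_le_max_left _ hyz.le)
  refine ⟨g, hg.mono fun n hn => hn.2.1, tendstoLocallyUniformlyOn_of_isPreconnected hD
    (isPreconnected_iff_preconnectedSpace.2 inferInstance) hgd hgb differentiableOn_id
    isOpen_ball (V := B) ⟨a, haD, mem_ball_self hr⟩ ?_⟩
  exact tendstoLocallyUniformlyOn_leftInverse hD isOpen_ball (fun w hw => (hball hw).1) hgd hgb
    (hg.mono fun n hn => hn.2.2.1) (hlim.mono hBV)

/-- Inverse branches of the returning iterates converge to the identity on all of `D`, so near the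
attracting point `α` they undo the contraction towards `α`. -/
theorem not_isRigidOn (hG : IsProperHolomorphicOn G E)
    (hesc : ∀ w ∈ E, ρ ≤ ‖w‖ → ‖w‖ ≤ ‖G w‖) (hD : IsOpen D) [SimplyConnectedSpace D]
    (hcrit : ∀ w ∈ E, deriv G w = 0 → ∀ k, G^[k + 1] w ∉ D) {α : ℂ} (hα : α ∈ closure D)
    (hαD : α ∉ D) (hαE : α ∈ E) (hfix : G α = α) (hattr : ‖deriv G α‖ < 1) (hV : IsOpen V)
    (hDV : (D ∩ V).Nonempty) (hVE : ∀ n, V ⊆ iterateDomain G E n) : ¬ IsRigidOn G V := by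
  rintro ⟨l, hne, hl, htendsto⟩
  have hlim : TendstoLocallyUniformlyOn (fun n => G^[n]) id l V :=
    (tendstoLocallyUniformlyOn_iff_tendsto_prod hV continuousOn_id).2 htendsto
  obtain ⟨g, hinv, hg⟩ := hG.exists_inverseBranches_tendsto_id hesc hD hcrit hV hDV hVE hlim
  obtain ⟨η, hη, hbasin⟩ := exists_tendstoUniformlyOn_iterate_of_norm_deriv_lt_one
    (hG.hasStrictDerivAt hαE).hasDerivAt hfix hattr
  obtain ⟨w, hwα, hwD⟩ := mem_closure_iff_nhds.1 hα (ball α η) (ball_mem_nhds α hη)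
  have hgw : ∀ᶠ n in l, g n w ∈ ball α η :=
    (hg.tendsto_at hwD).eventually (isOpen_ball.mem_nhds hwα)
  have hw : Tendsto (fun n => G^[n] (g n w)) l (𝓝 α) := by
    refine Metric.tendsto_nhds.2 fun ε hε => ?_
    filter_upwards [hl (Metric.tendstoUniformlyOn_iff.1 hbasin ε hε), hgw] with n hn hgn
    exact dist_comm α _ ▸ hn _ hgn
  have hconst : Tendsto (fun n => G^[n] (g n w)) l (𝓝 w) :=
    tendsto_const_nhds.congr' (hinv.mono fun n hn => (hn hwD).symm)
  exact hαD (tendsto_nhds_unique hconst hw ▸ hwD)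

end IsProperHolomorphicOn

end Rigidity

section ChartFormulas

/-- The denominator of Halley's map for the cubic `z³ + 6z + b` with root `r`, in the coordinate
`w = 1 / (z - r)`. -/
def chartDenom (r w : ℂ) : ℂ := 1 + 3 * r * w + (2 * r ^ 2 - 2) * w ^ 2

/-- The cofactor of `w` in the numerator of Halley's map in the coordinate `w = 1 / (z - r)`. -/
def chartNum (r w : ℂ) : ℂ :=
  2 + 8 * r * w + (12 * r ^ 2 + 6) * w ^ 2 + 9 * r * (r ^ 2 + 2) * w ^ 3 +
    3 * (r ^ 2 + 2) ^ 2 * w ^ 4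

/-- Halley's map in the coordinate `w = 1 / (z - r)`, off the points that it sends to the
root `r`, that is, to `w = ∞`. -/
def chartHalley (r w : ℂ) : ℂ := w * chartNum r w / chartDenom r w

/-- The points that Halley's map does not send to `r`, in the coordinate `w = 1 / (z - r)`. -/
def chartDomain (r : ℂ) : Set ℂ := {w | chartDenom r w ≠ 0}

/-- The quadratic whose zeros are the roots of the cubic other than `r`, in the coordinate
`w = 1 / (z - r)`. -/
def chartQuad (r w : ℂ) : ℂ := 1 + 3 * r * w + 3 * (r ^ 2 + 2) * w ^ 2

variable {r w : ℂ}

@[fun_prop]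
theorem continuous_chartDenom (r : ℂ) : Continuous (chartDenom r) := by
  unfold chartDenom; fun_prop

@[fun_prop]
theorem continuous_chartNum (r : ℂ) : Continuous (chartNum r) := by
  unfold chartNum; fun_prop

theorem isOpen_chartDomain (r : ℂ) : IsOpen (chartDomain r) :=
  isOpen_ne_fun (continuous_chartDenom r) continuous_const

theorem ne_zero_of_chartDenom_eq_zero (h : chartDenom r w = 0) : w ≠ 0 := by
  rintro rfl
  simp [chartDenom] at h

theorem chartDenom_ne_zero_of_chartQuad_eq_zero (hr : r ^ 2 + 8 ≠ 0) (h : chartQuad r w = 0) :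
    chartDenom r w ≠ 0 := by
  intro h'
  have hprod : (r ^ 2 + 8) * w ^ 2 = 0 := by
    rw [chartQuad] at h
    rw [chartDenom] at h'
    linear_combination h - h'
  exact mul_ne_zero hr (pow_ne_zero 2 (ne_zero_of_chartDenom_eq_zero h')) hprod

theorem chartNum_sub_chartDenom (r w : ℂ) :
    chartNum r w - chartDenom r w = chartQuad r w * (1 + 2 * r * w + (r ^ 2 + 2) * w ^ 2) := by
  simp only [chartNum, chartDenom, chartQuad]
  ring

theorem chartNum_ne_zero_of_chartDenom_eq_zero (hr : r ^ 2 + 8 ≠ 0) (h : chartDenom r w = 0) :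
    chartNum r w ≠ 0 := by
  intro h0
  have hw := ne_zero_of_chartDenom_eq_zero h
  have hprod := chartNum_sub_chartDenom r w
  rw [h, h0, sub_zero] at hprod
  have hquad : 1 + 2 * r * w + (r ^ 2 + 2) * w ^ 2 = 0 := (mul_eq_zero.1 hprod.symm).resolve_left
    fun h' => chartDenom_ne_zero_of_chartQuad_eq_zero hr h' h
  rw [chartDenom] at h
  have hlin : r * (1 + r * w) = 4 * w :=
    mul_right_cancel₀ hw (by linear_combination h - hquad)
  refine mul_ne_zero hr (pow_ne_zero 2 hw) ?_
  linear_combination (1 / 2 : ℂ) * r ^ 2 * hquad - (1 / 2 : ℂ) * (r * (1 + r * w) + 4 * w) * hlin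

theorem chartHalley_eq_self (hr : r ^ 2 + 8 ≠ 0) (h : chartQuad r w = 0) :
    chartHalley r w = w := by
  have heq := chartNum_sub_chartDenom r w
  rw [h, zero_mul, sub_eq_zero] at heq
  rw [chartHalley, heq, mul_div_cancel_right₀ _ (chartDenom_ne_zero_of_chartQuad_eq_zero hr h)]

theorem hasDerivAt_chartDenom (r w : ℂ) :
    HasDerivAt (chartDenom r) (3 * r + 2 * (2 * r ^ 2 - 2) * w) w := by
  refine ((((hasDerivAt_id' w).const_mul (3 * r)).const_add 1).fun_add
    ((hasDerivAt_pow 2 w).const_mul (2 * r ^ 2 - 2))).congr_deriv ?_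
  push_cast
  ring

theorem hasDerivAt_chartNum (r w : ℂ) :
    HasDerivAt (chartNum r)
      (8 * r + 2 * (12 * r ^ 2 + 6) * w + 3 * (9 * r * (r ^ 2 + 2)) * w ^ 2 +
        4 * (3 * (r ^ 2 + 2) ^ 2) * w ^ 3) w := by
  refine ((((((hasDerivAt_id' w).const_mul (8 * r)).const_add 2).fun_add
    ((hasDerivAt_pow 2 w).const_mul (12 * r ^ 2 + 6))).fun_add
    ((hasDerivAt_pow 3 w).const_mul (9 * r * (r ^ 2 + 2)))).fun_add
    ((hasDerivAt_pow 4 w).const_mul (3 * (r ^ 2 + 2) ^ 2))).congr_deriv ?_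
  push_cast
  ring

theorem hasDerivAt_chartHalley (h : w ∈ chartDomain r) :
    HasDerivAt (chartHalley r)
      (2 * chartQuad r w ^ 2 * ((1 + r * w) ^ 2 - w ^ 2) / chartDenom r w ^ 2) w := by
  have hnum := (hasDerivAt_id' w).mul (hasDerivAt_chartNum r w)
  refine (hnum.div (hasDerivAt_chartDenom r w) h).congr_deriv ?_
  congr 1
  simp only [Pi.mul_apply, chartNum, chartDenom, chartQuad]
  ring

theorem eventually_norm_chartDenom_lt_norm_chartNum (hr : r ^ 2 + 2 ≠ 0) :
    ∀ᶠ w in Bornology.cobounded ℂ, ‖chartDenom r w‖ < ‖chartNum r w‖ := by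
  have hdenom : Tendsto (fun u : ℂ => ‖u ^ 2 * (u ^ 2 + 3 * r * u + (2 * r ^ 2 - 2))‖)
      (𝓝 0) (𝓝 0) := Continuous.tendsto' (by fun_prop) _ _ (by simp)
  have hnum : Tendsto (fun u : ℂ => ‖2 * u ^ 4 + 8 * r * u ^ 3 + (12 * r ^ 2 + 6) * u ^ 2 +
      9 * r * (r ^ 2 + 2) * u + 3 * (r ^ 2 + 2) ^ 2‖) (𝓝 0) (𝓝 ‖3 * (r ^ 2 + 2) ^ 2‖) :=
    Continuous.tendsto' (by fun_prop) _ _ (by simp)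
  have hpos : 0 < ‖3 * (r ^ 2 + 2) ^ 2‖ :=
    norm_pos_iff.2 (mul_ne_zero three_ne_zero (pow_ne_zero 2 hr))
  filter_upwards [tendsto_inv₀_cobounded.eventually (hdenom.eventually_lt hnum hpos),
    Bornology.eventually_ne_cobounded (0 : ℂ)] with w hlt hw
  have hd : w⁻¹ ^ 2 * (w⁻¹ ^ 2 + 3 * r * w⁻¹ + (2 * r ^ 2 - 2)) = chartDenom r w * w⁻¹ ^ 4 := by
    rw [chartDenom]; field_simp
  have hn : 2 * w⁻¹ ^ 4 + 8 * r * w⁻¹ ^ 3 + (12 * r ^ 2 + 6) * w⁻¹ ^ 2 +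
      9 * r * (r ^ 2 + 2) * w⁻¹ + 3 * (r ^ 2 + 2) ^ 2 = chartNum r w * w⁻¹ ^ 4 := by
    rw [chartNum]; field_simp
  rw [hd, hn, norm_mul, norm_mul] at hlt
  exact lt_of_mul_lt_mul_right hlt (norm_nonneg _)

theorem exists_norm_le_norm_chartHalley (hr : r ^ 2 + 2 ≠ 0) :
    ∃ ρ : ℝ, ∀ w ∈ chartDomain r, ρ ≤ ‖w‖ → ‖w‖ ≤ ‖chartHalley r w‖ := by
  obtain ⟨ρ, -, hρ⟩ := hasBasis_cobounded_norm.eventually_iff.1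
    (eventually_norm_chartDenom_lt_norm_chartNum hr)
  refine ⟨ρ, fun w hw hle => ?_⟩
  rw [chartHalley, norm_div, norm_mul, le_div_iff₀ (norm_pos_iff.2 hw)]
  exact mul_le_mul_of_nonneg_left (hρ hle).le (norm_nonneg w)

theorem isClosed_ne_zero_inter_preimage_div {X 𝕜 : Type*} [TopologicalSpace X] [Field 𝕜]
    [TopologicalSpace 𝕜] [ContinuousMul 𝕜] [T2Space 𝕜] {p q : X → 𝕜} (hp : Continuous p)
    (hq : Continuous q) (hpq : ∀ x, q x = 0 → p x ≠ 0) {K : Set 𝕜} (hK : IsCompact K) :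
    IsClosed ({x | q x ≠ 0} ∩ (fun x => p x / q x) ⁻¹' K) := by
  have := isCompact_iff_compactSpace.1 hK
  have hclosed : IsClosed {y : X × K | p y.1 = y.2 * q y.1} :=
    isClosed_eq (by fun_prop) (by fun_prop)
  convert isClosedMap_fst_of_compactSpace _ hclosed using 1
  ext x
  constructor
  · rintro ⟨hx, hK⟩
    exact ⟨(x, ⟨_, hK⟩), (div_mul_cancel₀ _ hx).symm, rfl⟩
  · rintro ⟨⟨x, k, hk⟩, hx : p x = k * q x, rfl⟩
    have hqx : q x ≠ 0 := fun h0 => hpq x h0 (by rw [hx, h0, mul_zero])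
    refine ⟨hqx, ?_⟩
    rwa [mem_preimage, hx, mul_div_cancel_right₀ _ hqx]

theorem isProperHolomorphicOn_chartHalley (h₂ : r ^ 2 + 2 ≠ 0) (h₈ : r ^ 2 + 8 ≠ 0) :
    IsProperHolomorphicOn (chartHalley r) (chartDomain r) where
  isOpen := isOpen_chartDomain r
  differentiableOn w hw := (hasDerivAt_chartHalley hw).differentiableAt.differentiableWithinAt
  isCompact_inter_preimage K hK := by
    obtain ⟨ρ, hρ⟩ := exists_norm_le_norm_chartHalley h₂
    obtain ⟨C, hC⟩ := hK.isBounded.exists_norm_le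
    refine isCompact_of_isClosed_isBounded (isClosed_ne_zero_inter_preimage_div
      (by fun_prop) (by fun_prop) (fun w hw => mul_ne_zero (ne_zero_of_chartDenom_eq_zero hw)
        (chartNum_ne_zero_of_chartDenom_eq_zero h₈ hw)) hK) ?_
    refine isBounded_closedBall.subset fun w hw => mem_closedBall_zero_iff.2 (?_ : _ ≤ max ρ C)
    by_contra! hlt
    obtain ⟨hρw, hCw⟩ := max_lt_iff.1 hlt
    exact (hCw.trans_le (hρ w hw.1 hρw.le)).not_ge (hC _ hw.2)

end ChartFormulas

section RealRoot

variable {r : ℝ} {w : ℂ}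

theorem ofReal_sq_add_two_ne_zero (r : ℝ) : (r : ℂ) ^ 2 + 2 ≠ 0 := by
  norm_cast
  positivity

theorem ofReal_sq_add_eight_ne_zero (r : ℝ) : (r : ℂ) ^ 2 + 8 ≠ 0 := by
  norm_cast
  positivity

theorem im_chartHalley_eq_zero (h : w.im = 0) : (chartHalley r w).im = 0 := by
  rw [← Complex.conj_eq_iff_im] at h ⊢
  simp [chartHalley, chartNum, chartDenom, h, Complex.conj_ofNat]

theorem im_iterate_chartHalley_eq_zero (h : w.im = 0) (n : ℕ) :
    ((chartHalley r)^[n] w).im = 0 := by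
  induction n with
  | zero => exact h
  | succ n ih =>
    rw [Function.iterate_succ_apply']
    exact im_chartHalley_eq_zero ih

theorem im_eq_zero_of_one_add_ofReal_mul_eq_zero {t : ℝ} (h : 1 + t * w = 0) : w.im = 0 := by
  have hw : w = ((-t⁻¹ : ℝ) : ℂ) := by
    have ht : (t : ℂ) ≠ 0 := by
      rintro ht
      simp [ht] at h
    push_cast
    field_simp
    linear_combination h
  rw [hw, Complex.ofReal_im]

theorem im_eq_zero_or_chartQuad_eq_zero_of_deriv_eq_zero (hw : w ∈ chartDomain r)
    (h : deriv (chartHalley r) w = 0) : w.im = 0 ∨ chartQuad r w = 0 := by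
  rw [(hasDerivAt_chartHalley hw).deriv, div_eq_zero_iff,
    or_iff_left (pow_ne_zero 2 hw), mul_eq_zero, mul_eq_zero_iff_left two_ne_zero,
    pow_eq_zero_iff two_ne_zero, sq_sub_sq, mul_eq_zero] at h
  rcases h with hquad | hreal | hreal
  · exact Or.inr hquad
  · exact Or.inl (im_eq_zero_of_one_add_ofReal_mul_eq_zero (t := r + 1) (by
      push_cast; linear_combination hreal))
  · exact Or.inl (im_eq_zero_of_one_add_ofReal_mul_eq_zero (t := r - 1) (by
      push_cast; linear_combination hreal))

theorem exists_chartQuad_eq_zero_of_im_pos (r : ℝ) : ∃ α : ℂ, 0 < α.im ∧ chartQuad r α = 0 := by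
  have hsqrt : √(3 * r ^ 2 + 24) ^ 2 = 3 * r ^ 2 + 24 := Real.sq_sqrt (by positivity)
  have hr : r ^ 2 + 2 ≠ 0 := by positivity
  refine ⟨⟨-3 * r / (6 * (r ^ 2 + 2)), √(3 * r ^ 2 + 24) / (6 * (r ^ 2 + 2))⟩, by positivity, ?_⟩
  apply Complex.ext
  · simp [chartQuad, pow_two]
    field_simp
    linear_combination -3 * hsqrt
  · simp [chartQuad, pow_two]
    field_simp
    ring

theorem exists_chartQuad_eq_zero_of_im_ne_zero (r : ℝ) (hw : w.im ≠ 0) :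
    ∃ α : ℂ, 0 < w.im * α.im ∧ chartQuad r α = 0 := by
  obtain ⟨α, hα, hquad⟩ := exists_chartQuad_eq_zero_of_im_pos r
  rcases hw.lt_or_gt with hneg | hpos
  · refine ⟨starRingEnd ℂ α, mul_pos_of_neg_of_neg hneg (by simpa using hα), ?_⟩
    simpa [chartQuad, Complex.conj_ofNat] using congrArg (starRingEnd ℂ) hquad
  · exact ⟨α, mul_pos hpos hα, hquad⟩

theorem eq_of_chartQuad_eq_zero_of_im_mul_im_pos {α : ℂ} (hw : chartQuad r w = 0)
    (hα : chartQuad r α = 0) (him : 0 < w.im * α.im) : w = α := by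
  have hprod : (w - α) * (3 * r + 3 * (r ^ 2 + 2) * (w + α)) = 0 := by
    rw [chartQuad] at hw hα
    linear_combination hw - hα
  refine sub_eq_zero.1 ((mul_eq_zero.1 hprod).resolve_right fun hsum => ?_)
  have hsum_im : (3 * (r ^ 2 + 2)) * (w.im + α.im) = 0 := by
    simpa [pow_two] using congrArg Complex.im hsum
  have himw : w.im = -α.im :=
    eq_neg_of_add_eq_zero_left ((mul_eq_zero.1 hsum_im).resolve_left (by positivity))
  rw [himw] at him
  nlinarith [sq_nonneg α.im]

end RealRoot

section Rotation

variable {R S : Sphere → Sphere} {U : Set Sphere} {W : Set ℂ}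

theorem iterate_eq_symm_pow_mul {X : Type*} [TopologicalSpace X] {T : X → X}
    (φ : OpenPartialHomeomorph X ℂ) (hmaps : MapsTo T φ.source φ.source) {u : ℂ}
    (hu : ∀ z ∈ φ.target, φ (T (φ.symm z)) = u * z) {x : X} (hx : x ∈ φ.source) (n : ℕ) :
    T^[n] x = φ.symm (u ^ n * φ x) := by
  have hiter (n : ℕ) : T^[n] x ∈ φ.source := hmaps.iterate n hx
  have hφ : φ (T^[n] x) = u ^ n * φ x := by
    induction n with
    | zero => simp
    | succ n ih =>
      have hstep := hu _ (φ.map_source (hiter n))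
      rw [φ.left_inv (hiter n), ih] at hstep
      rw [Function.iterate_succ_apply', hstep, pow_succ', mul_assoc]
  rw [← hφ, φ.left_inv (hiter n)]

theorem exists_tendsto_circle_pow_one (u : Circle) :
    ∃ l : Filter ℕ, l.NeBot ∧ l ≤ atTop ∧ Tendsto (fun n => (u : ℂ) ^ n) l (𝓝 1) := by
  obtain ⟨N, hN, hlim⟩ := (mapClusterPt_one_atTop_pow u).tendsto_subseq
  refine ⟨map N atTop, inferInstance, hN.tendsto_atTop, tendsto_map'_iff.2 ?_⟩
  have hcoe : Continuous ((↑) : Circle → ℂ) := by fun_prop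
  have hpow : Tendsto (fun j => ((u ^ N j : Circle) : ℂ)) atTop (𝓝 ((1 : Circle) : ℂ)) :=
    (hcoe.tendsto 1).comp hlim
  simpa only [Function.comp_def, Circle.coe_pow, Circle.coe_one] using hpow

theorem IsConjToIrrationalRotation.isOpen (h : IsConjToIrrationalRotation S U W) : IsOpen U := by
  obtain ⟨-, φ, rfl, -⟩ := h
  exact φ.open_source

theorem IsConjToIrrationalRotation.isRigidOn (h : IsConjToIrrationalRotation S U W) :
    IsRigidOn S U := by
  obtain ⟨hmaps, φ, rfl, rfl, -, θ, -, hconj⟩ := h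
  set u : Circle := Circle.exp (2 * Real.pi * θ) with hu
  have hu_coe : Complex.exp (2 * Real.pi * Complex.I * θ) = u := by
    rw [hu, Circle.coe_exp]
    push_cast
    ring_nf
  rw [hu_coe] at hconj
  obtain ⟨l, hne, hl, hpow⟩ := exists_tendsto_circle_pow_one u
  refine ⟨l, hne, hl, fun x hx => ?_⟩
  have hrot : Tendsto (fun y : ℕ × Sphere => (u : ℂ) ^ y.1 * φ y.2) (l ×ˢ 𝓝 x) (𝓝 (φ x)) := by
    simpa using (hpow.comp tendsto_fst).mul ((φ.continuousAt hx).tendsto.comp tendsto_snd)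
  have hsymm := (φ.symm.continuousAt (φ.map_source hx)).tendsto.comp hrot
  rw [φ.left_inv hx] at hsymm
  refine hsymm.congr' ?_
  filter_upwards [tendsto_snd.eventually (φ.open_source.mem_nhds hx)] with y hy
  exact (iterate_eq_symm_pow_mul φ hmaps hconj hy y.1).symm

theorem IsFatouComponent.nonempty (h : IsFatouComponent R U) : U.Nonempty := by
  obtain ⟨z, hz, rfl⟩ := h
  exact ⟨z, mem_connectedComponentIn hz⟩

namespace IsRotationDomain

theorem nonempty (h : IsRotationDomain R U) : U.Nonempty := by
  rcases h with h | h <;> exact h.1.nonempty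

theorem exists_isConjToIrrationalRotation (h : IsRotationDomain R U) :
    ∃ k, 0 < k ∧ ∃ W, IsConjToIrrationalRotation R^[k] U W := by
  rcases h with ⟨-, k, hk, hconj⟩ | ⟨-, k, hk, ρ, -, hconj⟩ <;> exact ⟨k, hk, _, hconj⟩

theorem isOpen (h : IsRotationDomain R U) : IsOpen U := by
  obtain ⟨k, -, W, hconj⟩ := h.exists_isConjToIrrationalRotation
  exact hconj.isOpen

theorem isRigidOn (h : IsRotationDomain R U) : IsRigidOn R U := by
  obtain ⟨k, hk, W, hconj⟩ := h.exists_isConjToIrrationalRotation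
  exact hconj.isRigidOn.of_iterate hk

end IsRotationDomain

end Rotation

section RationalMaps

variable {P Q : ℂ[X]}

theorem ratMap_div_coe (hQ : Q ≠ 0) {z : ℂ} (h : Q.eval z = 0 → P.eval z ≠ 0) :
    ratMap (algebraMap ℂ[X] (RatFunc ℂ) P / algebraMap ℂ[X] (RatFunc ℂ) Q) (OnePoint.some z) =
      if Q.eval z = 0 then OnePoint.infty else OnePoint.some (P.eval z / Q.eval z) := by
  set R := algebraMap ℂ[X] (RatFunc ℂ) P / algebraMap ℂ[X] (RatFunc ℂ) Q with hR
  have heval : R.num.eval z * Q.eval z = P.eval z * R.denom.eval z := by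
    simpa only [eval_mul] using
      congrArg (Polynomial.eval z) ((RatFunc.num_mul_eq_mul_denom_iff hQ).2 hR)
  have hzero : R.denom.eval z = 0 ↔ Q.eval z = 0 := by
    refine ⟨fun h0 => ?_, fun h0 => ?_⟩
    · rw [h0, mul_zero] at heval
      refine (mul_eq_zero.1 heval).resolve_left fun hnum => ?_
      obtain ⟨u, v, huv⟩ := RatFunc.isCoprime_num_denom R
      simpa [h0, hnum] using congrArg (Polynomial.eval z) huv
    · rw [h0, mul_zero] at heval
      exact (mul_eq_zero.1 heval.symm).resolve_left (h h0)
  simp only [ratMap, hzero]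
  split_ifs with h0
  · rfl
  · rw [(div_eq_div_iff (hzero.not.2 h0) h0).2 heval]

theorem ratMap_div_infty (hdeg : Q.natDegree < P.natDegree) (hQ : Q ≠ 0) :
    ratMap (algebraMap ℂ[X] (RatFunc ℂ) P / algebraMap ℂ[X] (RatFunc ℂ) Q) OnePoint.infty =
      OnePoint.infty := by
  set R := algebraMap ℂ[X] (RatFunc ℂ) P / algebraMap ℂ[X] (RatFunc ℂ) Q with hR
  have heq : R.num * Q = P * R.denom := (RatFunc.num_mul_eq_mul_denom_iff hQ).2 hR
  have hP : P ≠ 0 := ne_zero_of_natDegree_gt hdeg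
  have hnum : R.num ≠ 0 := fun h0 => mul_ne_zero hP R.denom_ne_zero (by rw [← heq, h0, zero_mul])
  have hnatDegree := congrArg natDegree heq
  rw [natDegree_mul hnum hQ, natDegree_mul hP R.denom_ne_zero] at hnatDegree
  have hcoeff : R.denom.coeff (max R.num.natDegree R.denom.natDegree) = 0 :=
    coeff_eq_zero_of_natDegree_lt (lt_max_of_lt_left (by lia))
  simp only [ratMap, hcoeff, if_true]

end RationalMaps

section HalleyFormula

/-- The denominator of Halley's map `z - 2 p p' / (2 p'² - p p'')`. -/
def halleyDenom (p : ℂ[X]) : ℂ[X] := 2 * derivative p ^ 2 - p * derivative (derivative p)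

/-- The numerator of Halley's map over the denominator `halleyDenom p`. -/
def halleyNum (p : ℂ[X]) : ℂ[X] := X * halleyDenom p - 2 * p * derivative p

theorem halley_eq_div {p : ℂ[X]} (hp : halleyDenom p ≠ 0) :
    halley p = algebraMap ℂ[X] (RatFunc ℂ) (halleyNum p) /
      algebraMap ℂ[X] (RatFunc ℂ) (halleyDenom p) := by
  rw [halley, ← halleyDenom, ← RatFunc.algebraMap_X, sub_div' (RatFunc.algebraMap_ne_zero hp),
    ← map_mul, ← map_sub, ← halleyNum]

theorem eval_halleyDenom_of_isRoot {p : ℂ[X]} {r : ℂ} (hr : p.IsRoot r) :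
    (halleyDenom p).eval r = 2 * (derivative p).eval r ^ 2 := by
  simp [halleyDenom, hr.eq_zero]

theorem eval_halleyNum_of_isRoot {p : ℂ[X]} {r : ℂ} (hr : p.IsRoot r) :
    (halleyNum p).eval r = r * (halleyDenom p).eval r := by
  simp [halleyNum, hr.eq_zero]

theorem derivative_cubic (b : ℂ) : derivative (cubic b) = 3 * X ^ 2 + 6 := by
  simp only [cubic, derivative_add, derivative_mul, derivative_ofNat, derivative_X_pow,
    derivative_X, derivative_C, Nat.cast_ofNat, map_ofNat]
  ring

theorem derivative_derivative_cubic (b : ℂ) : derivative (derivative (cubic b)) = 6 * X := by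
  rw [derivative_cubic]
  simp only [derivative_add, derivative_mul, derivative_ofNat, derivative_X_pow, Nat.cast_ofNat,
    map_ofNat]
  ring

theorem halleyDenom_cubic (b : ℂ) :
    halleyDenom (cubic b) = C 12 * X ^ 4 + C 36 * X ^ 2 - C (6 * b) * X + C 72 := by
  rw [halleyDenom, derivative_derivative_cubic, derivative_cubic, cubic]
  simp only [map_mul, map_ofNat]
  ring

theorem halleyNum_cubic (b : ℂ) :
    halleyNum (cubic b) = C 6 * X ^ 5 - C 12 * X ^ 3 - C (12 * b) * X ^ 2 - C (12 * b) := by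
  rw [halleyNum, halleyDenom_cubic, derivative_cubic, cubic]
  simp only [map_mul, map_ofNat]
  ring

theorem natDegree_halleyDenom_cubic (b : ℂ) : (halleyDenom (cubic b)).natDegree = 4 := by
  rw [halleyDenom_cubic]
  compute_degree!

theorem natDegree_halleyNum_cubic (b : ℂ) : (halleyNum (cubic b)).natDegree = 5 := by
  rw [halleyNum_cubic]
  compute_degree!

/-- The cubic `z³ + 6 z + b` with the root `r`. -/
def rootedCubic (r : ℂ) : ℂ[X] := cubic (-(r ^ 3 + 6 * r))

variable {r w : ℂ}

theorem isRoot_rootedCubic (r : ℂ) : (rootedCubic r).IsRoot r := by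
  simp [rootedCubic, cubic]

theorem halleyDenom_rootedCubic_ne_zero (r : ℂ) : halleyDenom (rootedCubic r) ≠ 0 :=
  ne_zero_of_natDegree_gt (n := 0) (by simp [rootedCubic, natDegree_halleyDenom_cubic])

theorem eval_halleyDenom_rootedCubic (hw : w ≠ 0) :
    (halleyDenom (rootedCubic r)).eval (r + w⁻¹) = 6 * chartNum r w / w ^ 4 := by
  simp only [rootedCubic, halleyDenom_cubic, chartNum, eval_add, eval_sub, eval_mul, eval_pow,
    eval_X, eval_C]
  field_simp
  ring

theorem eval_halleyNum_rootedCubic (hw : w ≠ 0) :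
    (halleyNum (rootedCubic r)).eval (r + w⁻¹) =
      r * (6 * chartNum r w / w ^ 4) + 6 * chartDenom r w / w ^ 5 := by
  simp only [rootedCubic, halleyNum_cubic, chartNum, chartDenom, eval_sub, eval_mul, eval_pow,
    eval_X, eval_C]
  field_simp
  ring

theorem eval_halleyDenom_rootedCubic_self_ne_zero (hr : r ^ 2 + 2 ≠ 0) :
    (halleyDenom (rootedCubic r)).eval r ≠ 0 := by
  rw [eval_halleyDenom_of_isRoot (isRoot_rootedCubic r), rootedCubic, derivative_cubic]
  have heval : (3 * X ^ 2 + 6 : ℂ[X]).eval r = 3 * (r ^ 2 + 2) := by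
    simp only [eval_add, eval_mul, eval_pow, eval_X, eval_ofNat]
    ring
  rw [heval]
  exact mul_ne_zero two_ne_zero (pow_ne_zero 2 (mul_ne_zero three_ne_zero hr))

end HalleyFormula

section PartialSemiconj

variable {X Y : Type*} {G : X → X} {S : Y → Y} {e : X → Y} {E : Set X} {p : Y} {n : ℕ}

theorem iterate_apply_of_mem_iterateDomain (he : ∀ w ∈ E, S (e w) = e (G w)) {w : X}
    (hw : w ∈ iterateDomain G E n) : S^[n] (e w) = e (G^[n] w) := by
  induction n generalizing w with
  | zero => rfl
  | succ n ih =>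
    rw [iterateDomain_succ] at hw
    rw [Function.iterate_succ_apply, Function.iterate_succ_apply, he w hw.1, ih hw.2]

theorem iterate_apply_of_notMem_iterateDomain (he : ∀ w ∈ E, S (e w) = e (G w))
    (hep : ∀ w ∉ E, S (e w) = p) (hp : S p = p) {w : X} (hw : w ∉ iterateDomain G E n) :
    S^[n] (e w) = p := by
  induction n generalizing w with
  | zero => simp [iterateDomain_zero] at hw
  | succ n ih =>
    rw [Function.iterate_succ_apply]
    by_cases hwE : w ∈ E
    · rw [iterateDomain_succ] at hw
      rw [he w hwE]
      exact ih fun h => hw ⟨hwE, h⟩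
    · rw [hep w hwE, Function.iterate_fixed hp]

namespace IsRigidOn

variable [TopologicalSpace Y] {U : Set Y}

theorem preimage_subset_iterateDomain [T2Space Y] (hU : IsRigidOn S U)
    (he : ∀ w ∈ E, S (e w) = e (G w)) (hep : ∀ w ∉ E, S (e w) = p) (hp : S p = p)
    (hpe : p ∉ range e) (n : ℕ) : e ⁻¹' U ⊆ iterateDomain G E n := by
  obtain ⟨l, hne, hl, hlim⟩ := hU
  intro w hw
  by_contra hwn
  have hreturn : Tendsto (fun j => S^[j] (e w)) l (𝓝 (e w)) :=
    (hlim _ hw).comp (tendsto_id.prodMk tendsto_const_nhds)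
  have hescape : Tendsto (fun j => S^[j] (e w)) l (𝓝 p) := by
    refine tendsto_const_nhds.congr' ?_
    filter_upwards [hl (eventually_ge_atTop n)] with j hj
    exact (iterate_apply_of_notMem_iterateDomain he hep hp
      fun h => hwn (iterateDomain_anti hj h)).symm
  exact hpe ⟨w, tendsto_nhds_unique hreturn hescape⟩

theorem preimage [TopologicalSpace X] (hU : IsRigidOn S U) (hUo : IsOpen U)
    (hind : Topology.IsInducing e) (he : ∀ w ∈ E, S (e w) = e (G w))
    (hsub : ∀ n, e ⁻¹' U ⊆ iterateDomain G E n) : IsRigidOn G (e ⁻¹' U) := by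
  obtain ⟨l, hne, hl, hlim⟩ := hU
  refine ⟨l, hne, hl, fun w hw => ?_⟩
  rw [hind.tendsto_nhds_iff]
  refine ((hlim _ hw).comp (tendsto_fst.prodMk
    ((hind.continuous.tendsto w).comp tendsto_snd))).congr' ?_
  filter_upwards [tendsto_snd.eventually ((hUo.preimage hind.continuous).mem_nhds hw)] with y hy
  exact iterate_apply_of_mem_iterateDomain he (hsub _ hy)

end IsRigidOn

end PartialSemiconj

section RootChart

/-- The inverse `w ↦ r + 1 / w` of the coordinate `w = 1 / (z - r)` on the complement of `r` in the
sphere. -/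
def rootChart (r w : ℂ) : Sphere :=
  open scoped Classical in if w = 0 then OnePoint.infty else OnePoint.some (r + w⁻¹)

variable {r w : ℂ}

theorem rootChart_zero (r : ℂ) : rootChart r 0 = OnePoint.infty := if_pos rfl

theorem rootChart_of_ne_zero (hw : w ≠ 0) : rootChart r w = OnePoint.some (r + w⁻¹) := if_neg hw

theorem rootChart_ne_root (r w : ℂ) : rootChart r w ≠ OnePoint.some r := by
  rcases eq_or_ne w 0 with rfl | hw
  · rw [rootChart_zero]
    exact OnePoint.infty_ne_coe _
  · rw [rootChart_of_ne_zero hw, Ne, OnePoint.some_eq_iff]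
    simpa using hw

theorem rootChart_injective (r : ℂ) : Function.Injective (rootChart r) := by
  intro w₁ w₂ h
  rcases eq_or_ne w₁ 0 with rfl | h₁ <;> rcases eq_or_ne w₂ 0 with rfl | h₂
  · rfl
  · rw [rootChart_zero, rootChart_of_ne_zero h₂] at h
    exact absurd h (OnePoint.infty_ne_coe _)
  · rw [rootChart_zero, rootChart_of_ne_zero h₁] at h
    exact absurd h (OnePoint.coe_ne_infty _)
  · rw [rootChart_of_ne_zero h₁, rootChart_of_ne_zero h₂, OnePoint.some_eq_iff] at h
    simpa using h

theorem continuous_rootChart (r : ℂ) : Continuous (rootChart r) := by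
  refine continuous_iff_continuousAt.2 fun w => ?_
  rcases eq_or_ne w 0 with rfl | hw
  · rw [continuousAt_iff_punctured_nhds, rootChart_zero]
    have hpole : Tendsto (fun w : ℂ => r + w⁻¹) (𝓝[≠] 0) (coclosedCompact ℂ) := by
      rw [coclosedCompact_eq_cocompact, ← cobounded_eq_cocompact]
      exact (tendsto_const_add_cobounded _).comp tendsto_inv₀_nhdsNE_zero
    refine (OnePoint.tendsto_coe_infty.comp hpole).congr' ?_
    filter_upwards [self_mem_nhdsWithin] with w hw
    exact (rootChart_of_ne_zero hw).symm
  · have hcont : ContinuousAt (fun w : ℂ => OnePoint.some (r + w⁻¹)) w :=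
      OnePoint.continuous_coe.continuousAt.comp (continuousAt_const.add (continuousAt_inv₀ hw))
    refine hcont.congr ?_
    filter_upwards [isOpen_ne.mem_nhds hw] with y hy
    exact (rootChart_of_ne_zero hy).symm

theorem tendsto_rootChart_coclosedCompact (r : ℂ) :
    Tendsto (rootChart r) (coclosedCompact ℂ) (𝓝 (OnePoint.some r)) := by
  rw [coclosedCompact_eq_cocompact]
  have hlim : Tendsto (fun w : ℂ => r + w⁻¹) (cocompact ℂ) (𝓝 r) := by
    rw [← cobounded_eq_cocompact]
    simpa using (tendsto_const_nhds (x := r)).add tendsto_inv₀_cobounded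
  refine ((OnePoint.continuous_coe.tendsto r).comp hlim).congr' ?_
  filter_upwards [(isCompact_singleton (x := (0 : ℂ))).compl_mem_cocompact] with w hw
  exact (rootChart_of_ne_zero hw).symm

theorem exists_rootChart_eq {z : Sphere} (hz : z ≠ OnePoint.some r) : ∃ w, rootChart r w = z := by
  induction z using OnePoint.rec with
  | infty => exact ⟨0, rootChart_zero r⟩
  | coe z =>
    have hzr : z - r ≠ 0 := sub_ne_zero.2 fun h => hz (congrArg _ h)
    exact ⟨(z - r)⁻¹, by rw [rootChart_of_ne_zero (inv_ne_zero hzr), inv_inv, add_sub_cancel]⟩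

theorem bijective_elim_rootChart (r : ℂ) :
    Function.Bijective fun z : Sphere => z.elim (OnePoint.some r) (rootChart r) := by
  refine ⟨fun z₁ z₂ h => ?_, fun z => ?_⟩
  · induction z₁ using OnePoint.rec <;> induction z₂ using OnePoint.rec
    · rfl
    · exact absurd h.symm (rootChart_ne_root _ _)
    · exact absurd h (rootChart_ne_root _ _)
    · exact congrArg _ (rootChart_injective r h)
  · rcases eq_or_ne z (OnePoint.some r) with rfl | hz
    · exact ⟨OnePoint.infty, rfl⟩
    · obtain ⟨w, rfl⟩ := exists_rootChart_eq hz
      exact ⟨OnePoint.some w, rfl⟩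

/-- The Möbius transformation `w ↦ r + 1 / w` of the sphere, which extends `rootChart r` by
`∞ ↦ r`. -/
def rootHomeomorph (r : ℂ) : Sphere ≃ₜ Sphere :=
  Continuous.homeoOfEquivCompactToT2 (f := Equiv.ofBijective _ (bijective_elim_rootChart r)) <|
    (OnePoint.continuous_iff _).2 ⟨tendsto_rootChart_coclosedCompact r, continuous_rootChart r⟩

theorem rootHomeomorph_comp_coe (r : ℂ) : rootHomeomorph r ∘ OnePoint.some = rootChart r := rfl

theorem isOpenEmbedding_rootChart (r : ℂ) : Topology.IsOpenEmbedding (rootChart r) := by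
  rw [← rootHomeomorph_comp_coe]
  exact (rootHomeomorph r).isOpenEmbedding.comp OnePoint.isOpenEmbedding_coe

theorem denseRange_rootChart (r : ℂ) : DenseRange (rootChart r) := by
  rw [← rootHomeomorph_comp_coe]
  exact (rootHomeomorph r).surjective.denseRange.comp OnePoint.denseRange_coe
    (rootHomeomorph r).continuous

end RootChart

section HalleyMap

/-- Halley's map of the cubic `z³ + 6 z + b` with root `r`, as a self-map of the sphere. -/
def halleyMap (r : ℂ) : Sphere → Sphere := ratMap (halley (rootedCubic r))

variable {r w : ℂ}

theorem halleyMap_coe {z : ℂ} (hz : (halleyDenom (rootedCubic r)).eval z = 0 →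
    (halleyNum (rootedCubic r)).eval z ≠ 0) :
    halleyMap r (OnePoint.some z) = if (halleyDenom (rootedCubic r)).eval z = 0 then OnePoint.infty
      else OnePoint.some
        ((halleyNum (rootedCubic r)).eval z / (halleyDenom (rootedCubic r)).eval z) := by
  rw [halleyMap, halley_eq_div (halleyDenom_rootedCubic_ne_zero r),
    ratMap_div_coe (halleyDenom_rootedCubic_ne_zero r) hz]

theorem halleyMap_infty (r : ℂ) : halleyMap r OnePoint.infty = OnePoint.infty := by
  rw [halleyMap, halley_eq_div (halleyDenom_rootedCubic_ne_zero r)]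
  refine ratMap_div_infty ?_ (halleyDenom_rootedCubic_ne_zero r)
  rw [rootedCubic, natDegree_halleyDenom_cubic, natDegree_halleyNum_cubic]
  norm_num

theorem halleyMap_root (hr : r ^ 2 + 2 ≠ 0) :
    halleyMap r (OnePoint.some r) = OnePoint.some r := by
  have hne := eval_halleyDenom_rootedCubic_self_ne_zero hr
  rw [halleyMap_coe fun h => absurd h hne, if_neg hne,
    eval_halleyNum_of_isRoot (isRoot_rootedCubic r), mul_div_cancel_right₀ _ hne]

theorem halleyMap_rootChart (hw : w ∈ chartDomain r) :
    halleyMap r (rootChart r w) = rootChart r (chartHalley r w) := by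
  have hd : chartDenom r w ≠ 0 := hw
  rcases eq_or_ne w 0 with rfl | hw₀
  · rw [chartHalley, zero_mul, zero_div, rootChart_zero, halleyMap_infty]
  have hdenom := eval_halleyDenom_rootedCubic (r := r) hw₀
  have hnum := eval_halleyNum_rootedCubic (r := r) hw₀
  rcases eq_or_ne (chartNum r w) 0 with hn | hn
  · rw [hn, mul_zero, zero_div] at hdenom hnum
    rw [mul_zero, zero_add] at hnum
    have hne : 6 * chartDenom r w / w ^ 5 ≠ 0 :=
      div_ne_zero (mul_ne_zero (by norm_num) hd) (pow_ne_zero 5 hw₀)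
    rw [rootChart_of_ne_zero hw₀, halleyMap_coe fun _ => hnum ▸ hne, if_pos hdenom, chartHalley, hn,
      mul_zero, zero_div, rootChart_zero]
  · have hne : 6 * chartNum r w / w ^ 4 ≠ 0 :=
      div_ne_zero (mul_ne_zero (by norm_num) hn) (pow_ne_zero 4 hw₀)
    rw [← hdenom] at hne
    rw [rootChart_of_ne_zero hw₀, halleyMap_coe fun h => absurd h hne, if_neg hne, hdenom, hnum,
      chartHalley, rootChart_of_ne_zero (div_ne_zero (mul_ne_zero hw₀ hn) hd)]
    congr 1
    field_simp

theorem halleyMap_rootChart_of_notMem (hr : r ^ 2 + 8 ≠ 0) (hw : w ∉ chartDomain r) :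
    halleyMap r (rootChart r w) = OnePoint.some r := by
  have hd : chartDenom r w = 0 := not_not.1 hw
  have hw₀ := ne_zero_of_chartDenom_eq_zero hd
  have hdenom := eval_halleyDenom_rootedCubic (r := r) hw₀
  have hne : 6 * chartNum r w / w ^ 4 ≠ 0 := div_ne_zero
    (mul_ne_zero (by norm_num) (chartNum_ne_zero_of_chartDenom_eq_zero hr hd)) (pow_ne_zero 4 hw₀)
  rw [← hdenom] at hne
  rw [rootChart_of_ne_zero hw₀, halleyMap_coe fun h => absurd h hne, if_neg hne,
    eval_halleyNum_rootedCubic hw₀, hd, mul_zero, zero_div, add_zero, ← hdenom,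
    mul_div_cancel_right₀ _ hne]

end HalleyMap

section ConvexRegion

theorem exists_isOpen_convex_mem_closure_notMem {F : Type*} [AddCommGroup F] [TopologicalSpace F]
    [IsTopologicalAddGroup F] [Module ℝ F] [ContinuousSMul ℝ F] [LocallyConvexSpace ℝ F] [T1Space F]
    {H : Set F} (hHo : IsOpen H) (hH : Convex ℝ H) {x y : F} (hx : x ∈ H) (hy : y ∈ H)
    (hxy : x ≠ y) :
    ∃ D ⊆ H, IsOpen D ∧ Convex ℝ D ∧ y ∈ D ∧ x ∈ closure D ∧ x ∉ D := by
  obtain ⟨f, hf⟩ := geometric_hahn_banach_point_point hxy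
  have hconv : Convex ℝ {z | f x < f z} := convex_halfSpace_gt f.isLinear _
  refine ⟨H ∩ {z | f x < f z}, inter_subset_left,
    hHo.inter (isOpen_lt continuous_const f.continuous), hH.inter hconv, ⟨hy, hf⟩, ?_,
    fun h => lt_irrefl (f x) h.2⟩
  have hseg : openSegment ℝ x y ⊆ H ∩ {z | f x < f z} := by
    refine subset_inter (hH.openSegment_subset hx hy) ?_
    rintro _ ⟨a, b, ha, hb, hab, rfl⟩
    have hgap := mul_pos hb (sub_pos.2 hf)
    obtain rfl := eq_sub_of_add_eq hab
    simp only [mem_ofPred_eq, map_add, map_smul, smul_eq_mul]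
    linarith
  exact closure_mono hseg (segment_subset_closure_openSegment (left_mem_segment ℝ x y))

end ConvexRegion

section RealRoot

variable {r : ℝ}

theorem iterate_succ_chartHalley_notMem {D : Set ℂ} {α w : ℂ} (n : ℕ) (hw : w ∈ chartDomain r)
    (hderiv : deriv (chartHalley r) w = 0) (hD : ∀ z ∈ D, 0 < z.im * α.im) (hαD : α ∉ D)
    (hα : chartQuad r α = 0) : (chartHalley r)^[n + 1] w ∉ D := by
  intro hmem
  rcases im_eq_zero_or_chartQuad_eq_zero_of_deriv_eq_zero hw hderiv with him | hroot
  · have hpos := hD _ hmem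
    rw [im_iterate_chartHalley_eq_zero him, zero_mul] at hpos
    exact lt_irrefl 0 hpos
  · rw [Function.iterate_fixed (chartHalley_eq_self (ofReal_sq_add_eight_ne_zero r) hroot)] at hmem
    exact hαD (eq_of_chartQuad_eq_zero_of_im_mul_im_pos hroot hα (hD w hmem) ▸ hmem)

theorem not_isRigidOn_chartHalley {V : Set ℂ} (hV : IsOpen V) (hne : V.Nonempty)
    (hVE : ∀ n, V ⊆ iterateDomain (chartHalley r) (chartDomain r) n) :
    ¬ IsRigidOn (chartHalley r) V := by
  have h₂ := ofReal_sq_add_two_ne_zero r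
  have h₈ := ofReal_sq_add_eight_ne_zero r
  obtain ⟨v, hvV, hv⟩ :=
    ((dense_compl_singleton (0 : ℝ)).preimage Complex.isOpenMap_im).inter_open_nonempty V hV hne
  obtain ⟨α, hvα, hα⟩ := exists_chartQuad_eq_zero_of_im_ne_zero r hv
  set H : Set ℂ := {w | 0 < w.im * α.im}
  have hHo : IsOpen H := isOpen_lt continuous_const (by fun_prop)
  have hH : Convex ℝ H := convex_halfSpace_gt (f := fun w : ℂ => w.im * α.im)
    ⟨fun x y => by simp [add_mul], fun c x => by simp [mul_assoc]⟩ 0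
  obtain ⟨y, ⟨hyV, hyH⟩, hyα⟩ : ((V ∩ H) ∩ {α}ᶜ).Nonempty :=
    (dense_compl_singleton α).inter_open_nonempty _ (hV.inter hHo) ⟨v, hvV, hvα⟩
  have hαH : α ∈ H := mul_self_pos.2 (right_ne_zero_of_mul hvα.ne')
  obtain ⟨D, hDH, hDo, hDc, hyD, hαc, hαD⟩ :=
    exists_isOpen_convex_mem_closure_notMem hHo hH hαH hyH (Ne.symm hyα)
  have : ContractibleSpace D := hDc.contractibleSpace ⟨y, hyD⟩
  obtain ⟨ρ, hρ⟩ := exists_norm_le_norm_chartHalley h₂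
  have hαE : α ∈ chartDomain r := chartDenom_ne_zero_of_chartQuad_eq_zero h₈ hα
  have hattr : ‖deriv (chartHalley r) α‖ < 1 := by
    simp [(hasDerivAt_chartHalley hαE).deriv, hα]
  exact (isProperHolomorphicOn_chartHalley h₂ h₈).not_isRigidOn hρ hDo
    (fun w hw hderiv n => iterate_succ_chartHalley_notMem n hw hderiv hDH hαD hα) hαc hαD hαE
    (chartHalley_eq_self h₈ hα) hattr hV ⟨y, hyD, hyV⟩ hVE

theorem not_isRigidOn_halleyMap {U : Set Sphere} (hU : IsOpen U) (hne : U.Nonempty) :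
    ¬ IsRigidOn (halleyMap r) U := by
  intro hrigid
  have hchart : ∀ w ∈ chartDomain r, halleyMap r (rootChart r w) = rootChart r (chartHalley r w) :=
    fun w hw => halleyMap_rootChart hw
  have hsub := hrigid.preimage_subset_iterateDomain hchart
    (fun w hw => halleyMap_rootChart_of_notMem (ofReal_sq_add_eight_ne_zero r) hw)
    (halleyMap_root (ofReal_sq_add_two_ne_zero r)) fun ⟨w, hw⟩ => rootChart_ne_root r w hw
  have hemb := isOpenEmbedding_rootChart r
  refine not_isRigidOn_chartHalley (hU.preimage hemb.continuous) ?_ hsub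
    (hrigid.preimage hU hemb.isInducing hchart hsub)
  obtain ⟨_, hx, w, rfl⟩ := (denseRange_rootChart r).inter_open_nonempty U hU hne
  exact ⟨w, hx⟩

theorem surjective_pow_three_add_six_mul : Function.Surjective fun x : ℝ => x ^ 3 + 6 * x := by
  intro y
  have hcube : 0 ≤ |y| ^ 3 := by positivity
  refine mem_range_of_exists_le_of_exists_ge (by fun_prop) ⟨-|y|, ?_⟩ ⟨|y|, ?_⟩
  · linarith [neg_abs_le y, abs_nonneg y, Odd.neg_pow (by decide : Odd 3) |y|]
  · linarith [le_abs_self y, abs_nonneg y]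

theorem exists_rootedCubic_eq_cubic (b : ℝ) : ∃ r : ℝ, rootedCubic (r : ℂ) = cubic (b : ℂ) := by
  obtain ⟨r, hr⟩ := surjective_pow_three_add_six_mul (-b)
  refine ⟨r, congrArg cubic ?_⟩
  rw [neg_eq_iff_eq_neg]
  exact_mod_cast hr

end RealRoot

end HalleyDynamics

end

theorem mainTheorem5_general (b : ℝ) {U : Set HalleyDynamics.Sphere} (hU : IsOpen U)
    (hne : U.Nonempty) :
    ¬ HalleyDynamics.IsRigidOn
      (HalleyDynamics.ratMap (HalleyDynamics.halley (HalleyDynamics.cubic (b : ℂ)))) U := by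
  obtain ⟨r, hr⟩ := HalleyDynamics.exists_rootedCubic_eq_cubic b
  rw [← hr]
  exact HalleyDynamics.not_isRigidOn_halleyMap hU hne

theorem mainTheorem5 (b : ℝ) :
    ¬ ∃ U : Set HalleyDynamics.Sphere,
      HalleyDynamics.IsRotationDomain
        (HalleyDynamics.ratMap (HalleyDynamics.halley (HalleyDynamics.cubic (b : ℂ)))) U := by
  rintro ⟨U, hU⟩
  exact mainTheorem5_general b hU.isOpen hU.nonempty hU.isRigidOn
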